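/- All graphs are finite, undirected, without loops and multiple edges. A krausz $(k,m)$-partition of a graph $G$ is a family of cliques of $G$ (clusters) such that every edge of $G$ lies in at least one cluster, every vertex of $G$ belongs to at most $k$ clusters, and any two different clusters have at most $m$ vertices in common. The $m$-krausz dimension $kdim_m(G)$ is the minimum $k$ such that $G$ has a krausz $(k,m)$-partition. A graph $G$ is $(\infty,1)$-polar if $V(G)$ is the disjoint union of two (possibly empty) sets $A$ and $B$ such that every connected component of the subgraph $\overline{G}(A)$ of the complement of $G$ induced by $A$ is a complete graph (of any order), and every connected component of the induced subgraph $G(B)$ is a single vertex. For every fixed $k,m\geq 1$, the problem of deciding, for an input graph $G$, whether $kdim_m(G)\leq k$ is polynomially solvable in the class of $(\infty,1)$-polar graphs. That is, for all integers $k,m\ge 1$ there is a deterministic Turing machine which, given the adjacency matrix of any graph $G$, halts with a yes/no answer after a number of steps bounded by a polynomial (depending only on $k$ and $m$) in the length of the input, and whose answer is "yes" if and only if $kdim_m(G)\le k$ whenever $G$ is $(\infty,1)$-polar. -/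

import Mathlib

namespace Krausz

/-- `Q` is a krausz `(k,m)`-partition of `G`: a family of cliques (clusters) covering every edge
of `G`, such that every vertex belongs to at most `k` clusters and any two different clusters
have at most `m` vertices in common. -/
structure IsKrauszPartition {V : Type*} [DecidableEq V] (G : SimpleGraph V) (k m : ℕ)
    (Q : Finset (Finset V)) : Prop where
  isClique : ∀ C ∈ Q, G.IsClique (C : Set V)
  covers : ∀ u v : V, G.Adj u v → ∃ C ∈ Q, u ∈ C ∧ v ∈ C
  card_clusters_le : ∀ v : V, (Q.filter (fun C => v ∈ C)).card ≤ k
  card_inter_le : ∀ C ∈ Q, ∀ D ∈ Q, C ≠ D → (C ∩ D).card ≤ m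

/-- The `m`-krausz dimension of `G`: the least `k` such that `G` has a krausz
`(k,m)`-partition (and `⊤` if there is no such `k`, which cannot happen for a finite graph
and `m ≥ 1`). -/
noncomputable def kdim {V : Type*} [DecidableEq V] (m : ℕ) (G : SimpleGraph V) : ℕ∞ :=
  ⨅ k ∈ {k : ℕ | ∃ Q : Finset (Finset V), IsKrauszPartition G k m Q}, (k : ℕ∞)

/-- All connected components of `H` are complete graphs of order at most `α`. -/
def ComponentsCompleteOfOrderLE {V : Type*} (H : SimpleGraph V) (α : ℕ∞) : Prop :=
  ∀ c : H.ConnectedComponent, H.IsClique c.supp ∧ c.supp.encard ≤ α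

/-- `(α,β)`-polar graphs: the vertex set is the disjoint union of a set `A` and its complement
`B`, either of them possibly empty, such that all connected components of the subgraph of the
complement of `G` induced by `A` are complete of order at most `α`, and all connected components
of the subgraph of `G` induced by `B` are complete of order at most `β`. -/
def IsPolar {V : Type*} (α β : ℕ∞) (G : SimpleGraph V) : Prop :=
  ∃ A : Set V, ComponentsCompleteOfOrderLE (Gᶜ.induce A) α ∧
    ComponentsCompleteOfOrderLE (G.induce Aᶜ) β

/-- Finite simple graphs, as instances of a decision problem: the vertices are `0, …, n - 1`. -/
abbrev FinGraph : Type := Σ n : ℕ, SimpleGraph (Fin n)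

open Classical in
/-- A graph is presented to a machine by its adjacency matrix, row by row: every entry is
written as `some true` or `some false`, and every row is followed by the end marker `none`. -/
noncomputable def encodeGraph (G : FinGraph) : List (Option Bool) :=
  (List.finRange G.1).flatMap fun i =>
    ((List.finRange G.1).map fun j => some (decide (G.2.Adj i j))) ++ [none]

/-- A Boolean function on finite graphs is computable in polynomial time: some multi-stack Turing
machine with finite alphabets, started on the adjacency matrix of any graph, halts with the
value of the function as its output after a number of steps that is bounded by a polynomial
in the length of the input. -/
def IsPolyTime (f : FinGraph → Bool) : Prop :=
  ∃ M : Turing.TM2ComputableInPolyTime encodeGraph Computability.encodeBool f,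
    ∀ i : M.tm.K, Finite (M.tm.Γ i)

/-- The decision problem `P` is polynomially solvable in the class `C` of graphs: some
polynomial-time algorithm decides `P` correctly on all graphs of `C` (its answer on other
graphs does not matter). -/
def PolySolvableOn (C P : FinGraph → Prop) : Prop :=
  ∃ f : FinGraph → Bool, IsPolyTime f ∧ ∀ G : FinGraph, C G → (f G = true ↔ P G)

end Krausz

/-! Split the vertices into `A`, on which nonadjacency is an equivalence relation (so `A` is
complete multipartite), and an independent set `B`. In a krausz (k,m)-partition a vertex has at most
k pairwise nonadjacent neighbours, and a clique with more than k·km + 1 vertices lies in one cluster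
(`exists_cluster_of_large`).

If some degree exceeds a constant `D`, a transversal T of the classes of `A` is a large clique,
contained in a cluster C. Exchanging a vertex of T for another one of its class would give a second
cluster meeting C in more than m vertices, so `A` lies in C. Then C is exactly the set of vertices
of degree more than km, and `G` satisfies a split condition stated by degrees
(`split_of_large_degree`); conversely this condition yields a partition of any graph
(`hasKrauszPartition_of_split`). If all degrees are at most `D` and `A` spans no edge, `G` is
bipartite and a partition exists iff all degrees are at most k. If `A` spans an edge, boundedly many
vertices have positive degree (`card_pos_degree_le`), and the answer is an entry of a finite table.

All these conditions are regular properties of the adjacency matrix once every entry carries the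
truncated degrees of its row and column. A machine that computes these degrees in one pass and runs
a finite automaton in a second pass needs only linear time (`isPolyTime_of_isRegular`). -/

namespace Krausz

/-! ### Step-bounded reachability. -/

open Turing StateTransition

/-- `f` leads from `a` to `b` in at most `m` steps. -/
def ReachesIn {σ : Type*} (f : σ → Option σ) (m : ℕ) (a b : σ) : Prop :=
  Nonempty (EvalsToInTime f a (some b) m)

namespace ReachesIn

variable {σ : Type*} {f : σ → Option σ} {a b c : σ} {m n : ℕ}

theorem refl (a : σ) : ReachesIn f 0 a a := ⟨EvalsToInTime.refl f a⟩

theorem trans (h₁ : ReachesIn f m a b) (h₂ : ReachesIn f n b c) : ReachesIn f (m + n) a c := by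
  obtain ⟨h₁⟩ := h₁
  obtain ⟨h₂⟩ := h₂
  exact ⟨by simpa [add_comm] using EvalsToInTime.trans f m n a b (some c) h₁ h₂⟩

theorem mono (h : ReachesIn f m a b) (hmn : m ≤ n) : ReachesIn f n a b := by
  obtain ⟨h⟩ := h
  exact ⟨⟨h.toEvalsTo, h.steps_le_m.trans hmn⟩⟩

theorem single (h : f a = some b) : ReachesIn f 1 a b := ⟨⟨⟨1, h⟩, le_rfl⟩⟩

theorem head (h : f a = some b) (h' : ReachesIn f n b c) : ReachesIn f (n + 1) a c :=
  ((single h).trans h').mono (by omega)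

end ReachesIn

/-! ### The two-pass Turing machine. -/

namespace TwoPass

/-- The stacks of the two-pass machine. -/
inductive Stk
  | input | copy | left | right | rows | output
  deriving DecidableEq

instance : Fintype Stk :=
  ⟨{.input, .copy, .left, .right, .rows, .output}, fun k => by cases k <;> decide⟩

/-- The labels of the two-pass machine. -/
inductive Lbl
  | classify | scan | rewind | clear
  deriving DecidableEq

instance : Fintype Lbl :=
  ⟨{.classify, .scan, .rewind, .clear}, fun k => by cases k <;> decide⟩

variable {S Q : Type}

/-- The stack alphabets of the two-pass machine. -/
@[reducible] def Alphabet (S : Type) : Stk → Type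
  | .input => Option Bool
  | .copy => Option Bool
  | .left => S
  | .right => S
  | .rows => S
  | .output => Bool

/-- The internal memory of the two-pass machine. -/
structure Mem (S Q : Type) where
  /-- the class of the current row -/
  row : S
  /-- the state of the second automaton -/
  state : Q
  /-- the last matrix symbol read -/
  sym : Option (Option Bool)
  /-- the last class read -/
  cls : Option S

instance [Finite S] [Finite Q] : Finite (Mem S Q) :=
  Finite.of_injective (fun v : Mem S Q => (v.row, v.state, v.sym, v.cls)) (by
    rintro ⟨⟩ ⟨⟩ h
    simpa using h)

open TM2.Stmt in
/-- The program of the two-pass machine: the first pass runs `D` on every row of the matrix and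
stores the resulting class of the row, the second pass runs `E` backwards on the matrix whose
entries are annotated with the classes of their row and column. -/
noncomputable def program (D : DFA Bool S) (E : DFA (Option (S × S × Bool)) Q) :
    Lbl → TM2.Stmt (Alphabet S) Lbl (Mem S Q)
  | .classify =>
    pop .input (fun v (u : Option (Option Bool)) => { v with sym := u }) <|
    branch (fun v => v.sym = none) (goto fun _ => .scan) <|
    push .copy (fun v => v.sym.getD none) <|
    branch (fun v => v.sym = some none)
      (push .left (fun v => v.row) <| push .rows (fun v => v.row) <|
        load (fun v => { v with row := D.start }) <| goto fun _ => .classify)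
      (load (fun v => { v with row := D.step v.row ((v.sym.getD none).getD false) }) <|
        goto fun _ => .classify)
  -- The copy is in reverse order, so the end marker of a row is met before its entries. It fetches
  -- the class of the row and triggers the refill of `left`, which puts the class of the last column
  -- on top.
  | .scan =>
    pop .copy (fun v (u : Option (Option Bool)) => { v with sym := u }) <|
    branch (fun v => v.sym = none) (goto fun _ => .clear) <|
    branch (fun v => v.sym = some none)
      (pop .rows (fun v (u : Option S) => { v with row := u.getD D.start }) <|
        load (fun v => { v with state := E.step v.state none }) <| goto fun _ => .rewind)
      (pop .left (fun v (u : Option S) => { v with cls := u }) <|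
        push .right (fun v => v.cls.getD D.start) <|
        load (fun v => { v with
          state := E.step v.state
            (some (v.row, v.cls.getD D.start, (v.sym.getD none).getD false)) }) <|
        goto fun _ => .scan)
  | .rewind =>
    pop .right (fun v (u : Option S) => { v with cls := u }) <|
    branch (fun v => v.cls.isNone) (goto fun _ => .scan) <|
    push .left (fun v => v.cls.getD D.start) <| goto fun _ => .rewind
  | .clear =>
    pop .right (fun v (u : Option S) => { v with cls := u }) <|
    branch (fun v => v.cls.isNone)
      (push .output (fun v => open Classical in decide (v.state ∈ E.accept)) <|
        load (fun _ => ⟨D.start, E.start, none, none⟩) halt)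
      (goto fun _ => .clear)

/-- The two-pass machine. -/
noncomputable def machine [Finite S] [Finite Q] (D : DFA Bool S)
    (E : DFA (Option (S × S × Bool)) Q) : FinTM2 where
  K := Stk
  k₀ := .input
  k₁ := .output
  Γ := Alphabet S
  Λ := Lbl
  main := .classify
  σ := Mem S Q
  initialState := ⟨D.start, E.start, none, none⟩
  σFin := Fintype.ofFinite _
  Γk₀Fin := inferInstanceAs (Fintype (Option Bool))
  m := program D E

/-- The contents of the stacks. -/
def stk (i c : List (Option Bool)) (l r z : List S) (o : List Bool) :
    ∀ k, List (Alphabet S k)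
  | .input => i
  | .copy => c
  | .left => l
  | .right => r
  | .rows => z
  | .output => o

section

variable (i c : List (Option Bool)) (l r z : List S) (o : List Bool)

@[simp] theorem stk_input : stk i c l r z o .input = i := rfl
@[simp] theorem stk_copy : stk i c l r z o .copy = c := rfl
@[simp] theorem stk_left : stk i c l r z o .left = l := rfl
@[simp] theorem stk_right : stk i c l r z o .right = r := rfl
@[simp] theorem stk_rows : stk i c l r z o .rows = z := rfl
@[simp] theorem stk_output : stk i c l r z o .output = o := rfl

@[simp] theorem update_stk_input (i') :
    Function.update (stk i c l r z o) .input i' = stk i' c l r z o := by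
  funext k; cases k <;> rfl
@[simp] theorem update_stk_copy (c') :
    Function.update (stk i c l r z o) .copy c' = stk i c' l r z o := by
  funext k; cases k <;> rfl
@[simp] theorem update_stk_left (l') :
    Function.update (stk i c l r z o) .left l' = stk i c l' r z o := by
  funext k; cases k <;> rfl
@[simp] theorem update_stk_right (r') :
    Function.update (stk i c l r z o) .right r' = stk i c l r' z o := by
  funext k; cases k <;> rfl
@[simp] theorem update_stk_rows (z') :
    Function.update (stk i c l r z o) .rows z' = stk i c l r z' o := by
  funext k; cases k <;> rfl
@[simp] theorem update_stk_output (o') :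
    Function.update (stk i c l r z o) .output o' = stk i c l r z o' := by
  funext k; cases k <;> rfl

end

/-- The configuration with given label, memory and stacks. -/
abbrev cfg (t : Lbl) (v : Mem S Q) (s : ∀ k, List (Alphabet S k)) :
    TM2.Cfg (Alphabet S) Lbl (Mem S Q) := ⟨some t, v, s⟩

/-- The encoding of a Boolean matrix given by the list of its rows. -/
def encodeRows (rs : List (List Bool)) : List (Option Bool) :=
  rs.flatMap fun r => r.map some ++ [none]

variable (D : DFA Bool S) (E : DFA (Option (S × S × Bool)) Q)

theorem classify_row (b : List Bool) : ∀ (s : S) (q : Q) (u t) (i c l z),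
    ∃ u', ReachesIn (TM2.step (program D E)) (b.length + 1)
      (cfg .classify ⟨s, q, u, t⟩ (stk (b.map some ++ none :: i) c l [] z []))
      (cfg .classify ⟨D.start, q, u', t⟩
        (stk i (none :: (b.map some).reverse ++ c) (D.evalFrom s b :: l) []
          (D.evalFrom s b :: z) [])) := by
  induction b with
  | nil =>
    intro s q u t i c l z
    exact ⟨some none, .single (by simp [program, TM2.step])⟩
  | cons a b ih =>
    intro s q u t i c l z
    obtain ⟨u', h⟩ := ih (D.step s a) q (some (some a)) t i (some a :: c) l z
    refine ⟨u', .head (b := cfg .classify ⟨D.step s a, q, some (some a), t⟩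
      (stk (b.map some ++ none :: i) (some a :: c) l [] z [])) ?_ (by simpa using h)⟩
    simp [program, TM2.step]

theorem classify_rows (rs : List (List Bool)) : ∀ (q : Q) (u t) (c l z),
    ∃ u', ReachesIn (TM2.step (program D E)) (encodeRows rs).length
      (cfg .classify ⟨D.start, q, u, t⟩ (stk (encodeRows rs) c l [] z []))
      (cfg .classify ⟨D.start, q, u', t⟩
        (stk [] ((encodeRows rs).reverse ++ c) ((rs.map D.eval).reverse ++ l) []
          ((rs.map D.eval).reverse ++ z) [])) := by
  induction rs with
  | nil => intro q u t c l z; exact ⟨u, .refl _⟩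
  | cons r rs ih =>
    intro q u t c l z
    obtain ⟨u₁, h₁⟩ := classify_row D E r D.start q u t (encodeRows rs) c l z
    obtain ⟨u₂, h₂⟩ := ih q u₁ t (none :: (r.map some).reverse ++ c) (D.eval r :: l)
      (D.eval r :: z)
    refine ⟨u₂, ?_⟩
    have := h₁.trans h₂
    simpa [encodeRows, DFA.eval, add_comm, add_assoc, add_left_comm] using this

theorem rewind_all (y : List S) : ∀ (s : S) (q : Q) (u t) (c l z),
    ∃ t', ReachesIn (TM2.step (program D E)) (y.length + 1)
      (cfg .rewind ⟨s, q, u, t⟩ (stk [] c l y z []))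
      (cfg .scan ⟨s, q, u, t'⟩ (stk [] c (y.reverse ++ l) [] z [])) := by
  induction y with
  | nil =>
    intro s q u t c l z
    exact ⟨none, .single (by simp [program, TM2.step])⟩
  | cons a y ih =>
    intro s q u t c l z
    obtain ⟨t', h⟩ := ih s q u (some a) c (a :: l) z
    refine ⟨t', .head (b := cfg .rewind ⟨s, q, u, some a⟩ (stk [] c (a :: l) y z []))
      ?_ (by simpa using h)⟩
    simp [program, TM2.step]

/-- A halting configuration in the sense of `haltList` has the initial memory and no stack contents
besides the output, hence this clean-up phase. -/
theorem clear_all (y : List S) : ∀ (s : S) (q : Q) (u t),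
    ReachesIn (TM2.step (program D E)) (y.length + 1)
      (cfg .clear ⟨s, q, u, t⟩ (stk [] [] [] y [] []))
      ⟨none, ⟨D.start, E.start, none, none⟩,
        stk [] [] [] [] [] [open Classical in decide (q ∈ E.accept)]⟩ := by
  induction y with
  | nil =>
    intro s q u t
    exact .single (by simp [program, TM2.step])
  | cons a y ih =>
    intro s q u t
    refine .head (b := cfg .clear ⟨s, q, u, some a⟩ (stk [] [] [] y [] [])) ?_ (ih _ _ _ _)
    simp [program, TM2.step]

theorem scan_entries (w : List (S × Bool)) : ∀ (s : S) (q : Q) (u t) (c l y z),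
    ∃ u' t', ReachesIn (TM2.step (program D E)) w.length
      (cfg .scan ⟨s, q, u, t⟩
        (stk [] (w.map (fun e => some e.2) ++ c) (w.map Prod.fst ++ l) y z []))
      (cfg .scan ⟨s, E.evalFrom q (w.map fun e => some (s, e)), u', t'⟩
        (stk [] c l ((w.map Prod.fst).reverse ++ y) z [])) := by
  induction w with
  | nil => intro s q u t c l y z; exact ⟨u, t, .refl _⟩
  | cons e w ih =>
    intro s q u t c l y z
    obtain ⟨u', t', h⟩ := ih s (E.step q (some (s, e))) (some (some e.2)) (some e.1) c l
      (e.1 :: y) z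
    refine ⟨u', t', .head (b := cfg .scan ⟨s, E.step q (some (s, e)), some (some e.2),
      some e.1⟩ (stk [] (w.map (fun e => some e.2) ++ c) (w.map Prod.fst ++ l) (e.1 :: y)
        z [])) ?_ (by simpa using h)⟩
    simp [program, TM2.step]

/-- The annotation of a row `r` with its class and the list `cl` of the classes of the columns,
followed by an end marker. -/
def annotateRow (cl : List S) (r : List Bool) : List (Option (S × S × Bool)) :=
  (cl.zip r).map (fun e => some (D.eval r, e)) ++ [none]

/-- The hypothesis `hy` covers both possible situations: before the first row read all column
classes are on `left`, afterwards all are on `right`. The marker costs one step, the refill at most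
`cl.length + 1`, the entries `cl.length`. -/
theorem scan_row (cl : List S) (r : List Bool) (hr : r.length = cl.length)
    (s : S) (q : Q) (u t) (c) (l y z) (hy : y.reverse ++ l = cl.reverse) :
    ∃ s' u' t', ReachesIn (TM2.step (program D E)) (2 * cl.length + 2)
      (cfg .scan ⟨s, q, u, t⟩
        (stk [] (none :: (r.map some).reverse ++ c) l y (D.eval r :: z) []))
      (cfg .scan ⟨s', E.evalFrom q (annotateRow D cl r).reverse, u', t'⟩
        (stk [] c [] cl z [])) := by
  obtain ⟨t₁, h₁⟩ := rewind_all D E y (D.eval r) (E.step q none) (some none) t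
    ((r.map some).reverse ++ c) l z
  obtain ⟨u₂, t₂, h₂⟩ := scan_entries D E (cl.zip r).reverse (D.eval r) (E.step q none)
    (some none) t₁ c [] [] z
  have e₁ : (cl.zip r).map Prod.fst = cl := List.map_fst_zip (by omega)
  have e₂ : (cl.zip r).map (fun e => some e.2) = r.map some := by
    rw [← Function.comp_def, ← List.map_map, List.map_snd_zip (by omega)]
  refine ⟨D.eval r, u₂, t₂, ?_⟩
  rw [hy] at h₁
  simp only [List.map_reverse, e₁, e₂, List.append_nil, List.reverse_reverse,
    List.length_reverse] at h₂
  have h := ReachesIn.head (a := cfg .scan ⟨s, q, u, t⟩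
    (stk [] (none :: (r.map some).reverse ++ c) l y (D.eval r :: z) []))
    (by simp [program, TM2.step]) (h₁.trans h₂)
  have hl : y.length ≤ cl.length := by
    have := congrArg List.length hy
    simp at this
    omega
  have e₃ : E.evalFrom q (annotateRow D cl r).reverse =
      E.evalFrom (E.step q none) ((cl.zip r).map fun e => some (D.eval r, e)).reverse := by
    simp [annotateRow]
  rw [e₃]
  refine h.mono ?_
  simp [hr]
  omega

/-- Induction from the end of the list, since the last row is read first. The clauses on `l'` serve
to show that `left` is finally empty, also for the empty matrix. -/
theorem scan_rows (cl : List S) (rs : List (List Bool)) :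
    (∀ r ∈ rs, r.length = cl.length) → ∀ (s : S) (q : Q) (u t) (l y)
      (_ : y.reverse ++ l = cl.reverse),
    ∃ s' u' t' l' y', y'.reverse ++ l' = cl.reverse ∧ (rs ≠ [] → l' = []) ∧
      (rs = [] → l' = l) ∧
      ReachesIn (TM2.step (program D E)) (rs.length * (2 * cl.length + 2))
      (cfg .scan ⟨s, q, u, t⟩
        (stk [] (encodeRows rs).reverse l y (rs.map D.eval).reverse []))
      (cfg .scan ⟨s', E.evalFrom q (rs.flatMap (annotateRow D cl)).reverse, u', t'⟩
        (stk [] [] l' y' [] [])) := by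
  induction rs using List.reverseRecOn with
  | nil =>
    intro _ s q u t l y hy
    exact ⟨s, u, t, l, y, hy, by simp, by simp, (ReachesIn.refl _).mono (by simp)⟩
  | append_singleton rs r ih =>
    intro hrs s q u t l y hy
    obtain ⟨s₁, u₁, t₁, h₁⟩ := scan_row D E cl r (hrs r (by simp)) s q u t
      (encodeRows rs).reverse l y (rs.map D.eval).reverse hy
    obtain ⟨s₂, u₂, t₂, l₂, y₂, h₂, h₃, h₄, h₅⟩ := ih (fun r' h => hrs r' (by simp [h])) s₁
      (E.evalFrom q (annotateRow D cl r).reverse) u₁ t₁ [] cl (by simp)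
    refine ⟨s₂, u₂, t₂, l₂, y₂, h₂, fun _ => ?_, by simp, ?_⟩
    · by_cases h : rs = []
      · exact h₄ h
      · exact h₃ h
    · have := (h₁.trans h₅).mono (n := (rs ++ [r]).length * (2 * cl.length + 2))
        (by simp; ring_nf; omega)
      simpa [encodeRows, DFA.evalFrom_of_append] using this

theorem machine_run (rs : List (List Bool)) (hrs : ∀ r ∈ rs, r.length = rs.length) :
    ReachesIn (TM2.step (program D E)) (4 * (encodeRows rs).length + 3)
      (cfg .classify ⟨D.start, E.start, none, none⟩ (stk (encodeRows rs) [] [] [] [] []))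
      ⟨none, ⟨D.start, E.start, none, none⟩, stk [] [] [] [] [] [open Classical in
        decide (E.eval (rs.flatMap (annotateRow D (rs.map D.eval))).reverse ∈ E.accept)]⟩ := by
  obtain ⟨u₁, h₁⟩ := classify_rows D E rs E.start none none [] [] []
  obtain ⟨s₂, u₂, t₂, l, y, hy, hl, hl', h₂⟩ := scan_rows D E (rs.map D.eval) rs (by simpa using hrs)
    D.start E.start none none (rs.map D.eval).reverse [] (by simp)
  have hl0 : l = [] := by
    by_cases h : rs = []
    · simpa [h] using hl' h
    · exact hl h
  subst hl0
  have hlen : (encodeRows rs).length = rs.length * (rs.length + 1) := by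
    simp only [encodeRows, List.length_flatMap]
    rw [List.map_congr_left (g := fun _ => rs.length + 1)]
    · simp
    · intro r hr
      simp [hrs r hr]
  have hylen : y.length = rs.length := by simpa using congrArg List.length hy
  simp only [List.append_nil] at h₁
  have h₃ := ReachesIn.trans (h₁.trans (.single (b := cfg .scan ⟨D.start, E.start, none, none⟩
    (stk [] (encodeRows rs).reverse (rs.map D.eval).reverse [] (rs.map D.eval).reverse []))
    (by simp [program, TM2.step]))) h₂
  have h₄ := h₃.trans (.single (b := cfg .clear ⟨s₂, E.eval
    (rs.flatMap (annotateRow D (rs.map D.eval))).reverse, none, t₂⟩ (stk [] [] [] y [] []))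
    (by simp [program, TM2.step, DFA.eval]))
  -- For n rows the passes take n(n+1) and 2n(n+1) steps; the two changes of phase and the clearing
  -- add n + 3.
  refine (h₄.trans (clear_all D E y _ _ _ _)).mono ?_
  simp only [hylen, hlen, List.length_map]
  nlinarith

end TwoPass

/-- The adjacency matrix of a graph whose entries are annotated with the classes that `D` assigns
to their row and column. -/
noncomputable def annotatedMatrix {S : Type} (D : DFA Bool S) (G : FinGraph) :
    List (Option (S × S × Bool)) :=
  open Classical in
  (List.finRange G.1).flatMap fun i =>
    ((List.finRange G.1).map fun j => some
      (D.eval ((List.finRange G.1).map fun j => decide (G.2.Adj i j)),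
        D.eval ((List.finRange G.1).map fun i => decide (G.2.Adj j i)),
        decide (G.2.Adj i j))) ++ [none]

open TwoPass in
/-- Regular properties of the annotated adjacency matrix can be decided in polynomial time. -/
theorem isPolyTime_of_isRegular {S : Type} [Finite S] (D : DFA Bool S)
    {L : Language (Option (S × S × Bool))} (hL : L.IsRegular) (f : FinGraph → Bool)
    (hf : ∀ G, f G = true ↔ annotatedMatrix D G ∈ L) : IsPolyTime f := by
  classical
  -- The second pass reads the matrix backwards, so its automaton must recognise the reversal of
  -- `L`.
  obtain ⟨Q, _, E, hE⟩ := hL.reverse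
  have key : ∀ G : FinGraph, Nonempty (TM2OutputsInTime (machine D E)
      ((encodeGraph G).map (Equiv.refl (Option Bool)).invFun)
      (some ((Computability.encodeBool (f G)).map (Equiv.refl Bool).invFun))
      ((4 * Polynomial.X + 3 : Polynomial ℕ).eval (encodeGraph G).length)) := by
    intro G
    let row (i : Fin G.1) : List Bool := (List.finRange G.1).map fun j => decide (G.2.Adj i j)
    have h := machine_run D E ((List.finRange G.1).map row) (by simp [row])
    have e₁ : encodeRows ((List.finRange G.1).map row) = encodeGraph G := by
      simp only [encodeRows, encodeGraph, List.flatMap_map, row, List.map_map, Function.comp_def]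
    have e₂ : ((List.finRange G.1).map row).flatMap
        (annotateRow D (((List.finRange G.1).map row).map D.eval)) = annotatedMatrix D G := by
      simp only [List.flatMap_map, annotatedMatrix]
      congr 1
      funext i
      simp only [annotateRow, row, List.map_map, List.zip_map', Function.comp_def]
    have e₃ : decide (E.eval (annotatedMatrix D G).reverse ∈ E.accept) = f G := by
      rw [Bool.eq_iff_iff, hf, decide_eq_true_iff, ← DFA.mem_accepts, hE, Language.mem_reverse,
        List.reverse_reverse]
    rw [e₁, e₂, e₃] at h
    have e₄ : initList (machine D E) ((encodeGraph G).map (Equiv.refl (Option Bool)).invFun) =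
        cfg .classify ⟨D.start, E.start, none, none⟩ (stk (encodeGraph G) [] [] [] [] []) := by
      unfold initList
      congr 1
      funext k
      cases k <;> first | rfl | exact List.map_id _
    have e₅ : haltList (machine D E) ((Computability.encodeBool (f G)).map
        (Equiv.refl Bool).invFun) =
        ⟨none, ⟨D.start, E.start, none, none⟩, stk [] [] [] [] [] [f G]⟩ := by
      unfold haltList
      congr 1
      funext k
      cases k <;> rfl
    obtain ⟨h⟩ := h
    refine ⟨?_⟩
    unfold TM2OutputsInTime
    rw [Option.map_some, e₄, e₅]
    have e₆ : (4 * Polynomial.X + 3 : Polynomial ℕ).eval (encodeGraph G).length =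
        4 * (encodeGraph G).length + 3 := by
      simp
    rw [e₆]
    exact h
  refine ⟨⟨⟨machine D E, Equiv.refl _, Equiv.refl _⟩, 4 * Polynomial.X + 3,
    fun G => Classical.choice (key G)⟩, fun k => ?_⟩
  cases k
  · exact inferInstanceAs (Finite (Option Bool))
  · exact inferInstanceAs (Finite (Option Bool))
  · exact inferInstanceAs (Finite S)
  · exact inferInstanceAs (Finite S)
  · exact inferInstanceAs (Finite S)
  · exact inferInstanceAs (Finite Bool)

end Krausz

/-! ### Regular languages: counting in rows and finite tables. -/

namespace Krausz

/-- The automaton that checks that every row (every maximal block without `none`) of a word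
contains at most `t` letters satisfying `p`; its state is the number of such letters that are
still allowed in the current row. -/
def rowDFA {α : Type} (p : α → Bool) (t : ℕ) : DFA (Option α) (Option (Fin (t + 1))) where
  step
    | none, _ => none
    | some _, none => some (Fin.last t)
    | some c, some a =>
      if p a then (if c.1 = 0 then none else some ⟨c.1 - 1, by omega⟩) else some c
  start := some (Fin.last t)
  accept := {s | s.isSome}

/-- The language of all words with at most `t` letters satisfying `p` in every row. -/
noncomputable def rowBounded {α : Type} (p : α → Prop) (t : ℕ) : Language (Option α) :=
  open Classical in (rowDFA (fun a => decide (p a)) t).accepts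

theorem isRegular_rowBounded {α : Type} (p : α → Prop) (t : ℕ) : (rowBounded p t).IsRegular :=
  ⟨_, inferInstance, _, rfl⟩

theorem rowDFA_evalFrom_none {α : Type} (p : α → Bool) (t : ℕ) (w : List (Option α)) :
    (rowDFA p t).evalFrom none w = none := by
  induction w with
  | nil => rfl
  | cons a w ih => exact ih

theorem rowDFA_evalFrom_row {α : Type} (p : α → Bool) (t : ℕ) (r : List α) :
    ∀ c : Fin (t + 1), (rowDFA p t).evalFrom (some c) (r.map some ++ [none]) =
      if r.countP p ≤ c.1 then some (Fin.last t) else none := by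
  induction r with
  | nil => intro c; simp; rfl
  | cons a r ih =>
    intro c
    simp only [List.map_cons, List.cons_append, DFA.evalFrom_cons]
    by_cases ha : p a
    · by_cases hc : c.1 = 0
      · have : (rowDFA p t).step (some c) (some a) = none := by
          simp only [rowDFA, ha, hc, if_true]
        rw [this, rowDFA_evalFrom_none, if_neg]
        simp [ha, hc]
      · have : (rowDFA p t).step (some c) (some a) = some ⟨c.1 - 1, by omega⟩ := by
          simp only [rowDFA, ha, hc, if_true, if_false]
        rw [this, ih]
        simp only [List.countP_cons, ha, if_true]
        congr 1
        simp only [eq_iff_iff]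
        omega
    · have : (rowDFA p t).step (some c) (some a) = some c := by simp [rowDFA, ha]
      rw [this, ih]
      simp [ha]

theorem rowDFA_evalFrom_rows {α : Type} (p : α → Bool) (t : ℕ) (rs : List (List α)) :
    (rowDFA p t).evalFrom (some (Fin.last t)) (rs.flatMap (fun r => r.map some ++ [none])) =
      if ∀ r ∈ rs, r.countP p ≤ t then some (Fin.last t) else none := by
  induction rs with
  | nil => simp
  | cons r rs ih =>
    rw [List.flatMap_cons, DFA.evalFrom_of_append, rowDFA_evalFrom_row]
    by_cases hr : r.countP p ≤ t
    · rw [if_pos (by simpa using hr), ih]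
      simp [hr]
    · rw [if_neg (by simpa using hr), rowDFA_evalFrom_none, if_neg]
      simp [hr]

open Classical in
theorem flatMap_mem_rowBounded {α : Type} (p : α → Prop) (t : ℕ) (rs : List (List α)) :
    rs.flatMap (fun r => r.map some ++ [none]) ∈ rowBounded p t ↔
      ∀ r ∈ rs, r.countP (fun a => decide (p a)) ≤ t := by
  change (rowDFA (fun a => decide (p a)) t).evalFrom (some (Fin.last t)) _ ∈
    (rowDFA (fun a => decide (p a)) t).accept ↔ _
  rw [rowDFA_evalFrom_rows]
  split_ifs with h
  · simpa [rowDFA] using h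
  · simp [rowDFA, h]

/-- The words whose image under the filter `κ` lies in `F`. -/
def filterLanguage {α β : Type} (κ : α → Option β) (F : Set (List β)) : Language α :=
  {w | w.filterMap κ ∈ F}

/-- Membership of the filtered word in a set of words of bounded length is a regular property. -/
theorem isRegular_filterLanguage {α β : Type} [Finite β] (κ : α → Option β) (F : Set (List β)) (M : ℕ)
    (hF : ∀ l ∈ F, l.length ≤ M) :
    (filterLanguage κ F).IsRegular := by
  -- Myhill–Nerode: the quotient by `x` depends only on the filtered word of `x`, and is empty once
  -- that word is longer than `M`.
  apply Language.IsRegular.of_finite_range_leftQuotient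
  refine ((Set.finite_singleton (∅ : Set (List α))).union
    ((List.finite_length_le β M).image fun l => {y : List α | l ++ y.filterMap κ ∈ F})).subset ?_
  rintro _ ⟨x, rfl⟩
  by_cases hx : (x.filterMap κ).length ≤ M
  · right
    refine ⟨x.filterMap κ, hx, ?_⟩
    ext y
    change _ ↔ (x ++ y).filterMap κ ∈ F
    simp
  · left
    refine Set.eq_empty_iff_forall_notMem.2 fun y hy => hx ?_
    have hy : (x ++ y).filterMap κ ∈ F := hy
    have := hF _ hy
    simp at this
    omega

end Krausz

/-! ### Krausz partitions and polar graphs. -/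

namespace Krausz

variable {V W : Type*} [DecidableEq V] [DecidableEq W] {G : SimpleGraph V} {k m : ℕ}
  {Q : Finset (Finset V)}

/-- `G` has a krausz `(k,m)`-partition. -/
def HasKrauszPartition (G : SimpleGraph V) (k m : ℕ) : Prop :=
  ∃ Q : Finset (Finset V), IsKrauszPartition G k m Q

/-- The infimum, if finite, is attained, and a partition with a smaller parameter is also one with
parameter `k`. -/
theorem kdim_le_iff : kdim m G ≤ k ↔ HasKrauszPartition G k m := by
  constructor
  · intro h
    have h' : kdim m G < ((k + 1 : ℕ) : ℕ∞) := lt_of_le_of_lt h (by exact_mod_cast k.lt_succ_self)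
    simp only [kdim, iInf_lt_iff] at h'
    obtain ⟨j, ⟨Q, hQ⟩, hj⟩ := h'
    have hj : j < k + 1 := by exact_mod_cast hj
    exact ⟨Q, hQ.1, hQ.2, fun v => (hQ.3 v).trans (by omega), hQ.4⟩
  · intro h
    exact iInf₂_le k h

namespace IsKrauszPartition

/-- If `v` lies in clusters from `R` with each of the pairwise nonadjacent vertices of `I`, then
`I` has at most as many elements as `R`. -/
theorem card_le_of_cover (hQ : IsKrauszPartition G k m Q) {R : Finset (Finset V)} (hR : R ⊆ Q)
    {I : Finset V} (hI : G.IsIndepSet (I : Set V)) (h : ∀ u ∈ I, ∃ C ∈ R, u ∈ C) :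
    I.card ≤ R.card := by
  -- A cluster is a clique, so it contains at most one element of `I`; choosing clusters is
  -- therefore injective.
  choose! f hf hf' using h
  refine Finset.card_le_card_of_injOn f hf fun u hu w hw huw => ?_
  by_contra hne
  exact hI hu hw hne (hQ.isClique _ (hR (hf u hu)) (hf' u hu) (huw ▸ hf' w hw) hne)

/-- The neighbours of a vertex contain at most `k` pairwise nonadjacent vertices. -/
theorem card_indep_le (hQ : IsKrauszPartition G k m Q) {v : V} {I : Finset V}
    (hI : G.IsIndepSet (I : Set V)) (hv : ∀ u ∈ I, G.Adj v u) : I.card ≤ k := by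
  refine (hQ.card_le_of_cover (Finset.filter_subset _ _) hI fun u hu => ?_).trans
    (hQ.card_clusters_le v)
  obtain ⟨C, hC, h₁, h₂⟩ := hQ.covers _ _ (hv u hu)
  exact ⟨C, Finset.mem_filter.2 ⟨hC, h₁⟩, h₂⟩

/-- A set of neighbours of a vertex outside of a cluster `C` that is contained in `C` has at most
`k * m` elements. -/
theorem card_inter_cluster_le (hQ : IsKrauszPartition G k m Q) {C : Finset V} (hC : C ∈ Q) {w : V}
    (hw : w ∉ C) {T : Finset V} (hT : T ⊆ C) (hadj : ∀ u ∈ T, G.Adj w u) : T.card ≤ k * m := by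
  -- The clusters through `w` differ from `C`, so each meets `C` in at most m vertices; there are at
  -- most k of them.
  have hsub : T ⊆ (Q.filter fun D => w ∈ D).biUnion fun D => D ∩ C := by
    intro u hu
    obtain ⟨D, hD, h₁, h₂⟩ := hQ.covers _ _ (hadj u hu)
    exact Finset.mem_biUnion.2
      ⟨D, Finset.mem_filter.2 ⟨hD, h₁⟩, Finset.mem_inter.2 ⟨h₂, hT hu⟩⟩
  refine (Finset.card_le_card hsub).trans ((Finset.card_biUnion_le_card_mul _ _ m ?_).trans
    (Nat.mul_le_mul_right m (hQ.card_clusters_le w)))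
  intro D hD
  obtain ⟨hD, hwD⟩ := Finset.mem_filter.1 hD
  exact hQ.card_inter_le D hD C hC fun h => hw (h ▸ hwD)

/-- Large cliques are contained in clusters. -/
theorem exists_cluster_of_large (hQ : IsKrauszPartition G k m Q) {K : Finset V}
    (hK : G.IsClique (K : Set V)) (hcard : k * (k * m) + 1 < K.card) : ∃ C ∈ Q, K ⊆ C := by
  obtain ⟨v, hv⟩ : K.Nonempty := Finset.card_pos.1 (by omega)
  -- Pigeonhole: at most k clusters through `v` cover the more than k·km other vertices of `K`.
  have h : ∃ C ∈ Q, k * m < (C ∩ K).card := by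
    by_contra! hno
    have hsub : K.erase v ⊆ (Q.filter fun D => v ∈ D).biUnion fun D => D ∩ K := by
      intro u hu
      obtain ⟨hne, hu⟩ := Finset.mem_erase.1 hu
      obtain ⟨D, hD, h₁, h₂⟩ := hQ.covers _ _ (hK hv hu hne.symm)
      exact Finset.mem_biUnion.2
        ⟨D, Finset.mem_filter.2 ⟨hD, h₁⟩, Finset.mem_inter.2 ⟨h₂, hu⟩⟩
    have h₁ := (Finset.card_le_card hsub).trans
      ((Finset.card_biUnion_le_card_mul _ _ (k * m) fun D hD => hno D
        (Finset.mem_filter.1 hD).1).trans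
      (Nat.mul_le_mul_right (k * m) (hQ.card_clusters_le v)))
    rw [Finset.card_erase_of_mem hv] at h₁
    omega
  obtain ⟨C, hC, hlarge⟩ := h
  refine ⟨C, hC, fun w hw => ?_⟩
  by_contra hwC
  refine hlarge.not_ge (hQ.card_inter_cluster_le hC hwC Finset.inter_subset_left fun u hu => ?_)
  obtain ⟨h₁, h₂⟩ := Finset.mem_inter.1 hu
  exact hK hw h₂ fun h => hwC (h ▸ h₁)

/-- Krausz partitions can be pulled back along injective maps. -/
theorem comap {H : SimpleGraph W} {Q : Finset (Finset W)} (hQ : IsKrauszPartition H k m Q)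
    (f : V ↪ W) (hf : ∀ u v, G.Adj u v ↔ H.Adj (f u) (f v)) : HasKrauszPartition G k m := by
  let g : Finset W → Finset V := fun C => C.preimage f f.injective.injOn
  have hg : ∀ C v, v ∈ g C ↔ f v ∈ C := fun C v => by simp [g]
  refine ⟨Q.image g, ?_, ?_, ?_, ?_⟩
  · intro C' hC'
    obtain ⟨C, hC, rfl⟩ := Finset.mem_image.1 hC'
    intro u hu v hv huv
    exact (hf u v).2 (hQ.isClique C hC ((hg C u).1 hu) ((hg C v).1 hv) (f.injective.ne huv))
  · intro u v huv
    obtain ⟨C, hC, h₁, h₂⟩ := hQ.covers _ _ ((hf u v).1 huv)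
    exact ⟨g C, Finset.mem_image_of_mem g hC, (hg C u).2 h₁, (hg C v).2 h₂⟩
  · intro v
    refine le_trans ?_ (hQ.card_clusters_le (f v))
    refine (Finset.card_le_card (t := (Q.filter fun C => f v ∈ C).image g) ?_).trans
      Finset.card_image_le
    intro C' hC'
    obtain ⟨h₁, h₂⟩ := Finset.mem_filter.1 hC'
    obtain ⟨C, hC, rfl⟩ := Finset.mem_image.1 h₁
    exact Finset.mem_image_of_mem g (Finset.mem_filter.2 ⟨hC, (hg C v).1 h₂⟩)
  · intro C' hC' D' hD' hne
    obtain ⟨C, hC, rfl⟩ := Finset.mem_image.1 hC'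
    obtain ⟨D, hD, rfl⟩ := Finset.mem_image.1 hD'
    refine le_trans ?_ (hQ.card_inter_le C hC D hD fun h => hne (h ▸ rfl))
    refine Finset.card_le_card_of_injOn f (fun v hv => ?_) f.injective.injOn
    simpa [hg] using hv

/-- Krausz partitions can be pushed forward along injective maps whose range contains all
vertices of positive degree. -/
theorem map {H : SimpleGraph W} (hQ : IsKrauszPartition G k m Q)
    (f : V ↪ W) (hf : ∀ u v, G.Adj u v ↔ H.Adj (f u) (f v))
    (hrange : ∀ u v, H.Adj u v → u ∈ Set.range f) : HasKrauszPartition H k m := by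
  have hinj : Function.Injective (Finset.map f) := Finset.map_injective f
  refine ⟨Q.image (Finset.map f), ?_, ?_, ?_, ?_⟩
  · intro C' hC'
    obtain ⟨C, hC, rfl⟩ := Finset.mem_image.1 hC'
    intro u hu v hv huv
    obtain ⟨u, hu', rfl⟩ := Finset.mem_map.1 hu
    obtain ⟨v, hv', rfl⟩ := Finset.mem_map.1 hv
    exact (hf u v).1 (hQ.isClique C hC hu' hv' fun h => huv (h ▸ rfl))
  · intro u v huv
    obtain ⟨u, rfl⟩ := hrange u v huv
    obtain ⟨v, rfl⟩ := hrange v _ huv.symm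
    obtain ⟨C, hC, h₁, h₂⟩ := hQ.covers _ _ ((hf u v).2 huv)
    exact ⟨C.map f, Finset.mem_image_of_mem _ hC, Finset.mem_map_of_mem f h₁,
      Finset.mem_map_of_mem f h₂⟩
  · intro w
    by_cases hw : w ∈ Set.range f
    · obtain ⟨v, rfl⟩ := hw
      refine le_trans ?_ (hQ.card_clusters_le v)
      refine (Finset.card_le_card (t := (Q.filter fun C => v ∈ C).image (Finset.map f)) ?_).trans
        Finset.card_image_le
      intro C' hC'
      obtain ⟨h₁, h₂⟩ := Finset.mem_filter.1 hC'
      obtain ⟨C, hC, rfl⟩ := Finset.mem_image.1 h₁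
      exact Finset.mem_image_of_mem _ (Finset.mem_filter.2 ⟨hC, by simpa using h₂⟩)
    · rw [Finset.filter_eq_empty_iff.2]
      · simp
      intro C' hC' hwC
      obtain ⟨C, hC, rfl⟩ := Finset.mem_image.1 hC'
      obtain ⟨v, -, rfl⟩ := Finset.mem_map.1 hwC
      exact hw ⟨v, rfl⟩
  · intro C' hC' D' hD' hne
    obtain ⟨C, hC, rfl⟩ := Finset.mem_image.1 hC'
    obtain ⟨D, hD, rfl⟩ := Finset.mem_image.1 hD'
    rw [← Finset.map_inter, Finset.card_map]
    exact hQ.card_inter_le C hC D hD fun h => hne (h ▸ rfl)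

end IsKrauszPartition

/-- The structure of an `(∞,1)`-polar graph: nonadjacency is transitive on `A`, and the
complement of `A` is independent. -/
theorem IsPolar.exists_set {V : Type*} {G : SimpleGraph V} (h : IsPolar ⊤ 1 G) : ∃ A : Set V,
    (∀ u ∈ A, ∀ v ∈ A, ∀ w ∈ A, ¬G.Adj u v → ¬G.Adj v w → ¬G.Adj u w) ∧
      ∀ u ∉ A, ∀ v ∉ A, ¬G.Adj u v := by
  obtain ⟨A, hA, hB⟩ := h
  refine ⟨A, ?_, ?_⟩
  · intro u hu v hv w hw huv hvw huw
    by_cases h₁ : u = v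
    · exact hvw (h₁ ▸ huw)
    by_cases h₂ : v = w
    · exact huv (h₂ ▸ huw)
    have a₁ : (Gᶜ.induce A).Adj ⟨u, hu⟩ ⟨v, hv⟩ := by simp [h₁, huv]
    have a₂ : (Gᶜ.induce A).Adj ⟨v, hv⟩ ⟨w, hw⟩ := by simp [h₂, hvw]
    have := (hA ((Gᶜ.induce A).connectedComponentMk ⟨u, hu⟩)).1 rfl
      (SimpleGraph.ConnectedComponent.eq.2 (a₁.reachable.trans a₂.reachable).symm)
      (by simpa using huw.ne)
    simp [huw] at this
  · intro u hu v hv huv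
    have a : (G.induce Aᶜ).Adj ⟨u, hu⟩ ⟨v, hv⟩ := by simpa using huv
    have := Set.encard_le_one_iff.1 (hB ((G.induce Aᶜ).connectedComponentMk ⟨u, hu⟩)).2
      ⟨u, hu⟩ ⟨v, hv⟩ rfl (SimpleGraph.ConnectedComponent.eq.2 a.reachable.symm)
    exact huv.ne (by simpa using this)

/-- A set of at most `k * m` elements can be divided into `k` parts of at most `m` elements. -/
theorem exists_partition_card_le (hm : 1 ≤ m) (s : Finset V) (hs : s.card ≤ k * m) :
    ∃ χ : V → ℕ, (∀ v ∈ s, χ v < k) ∧ ∀ j, (s.filter fun v => χ v = j).card ≤ m := by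
  obtain ⟨e, he⟩ : ∃ e : V → ℕ, (∀ v ∈ s, e v < s.card) ∧ Set.InjOn e s := by
    refine ⟨fun v => if h : v ∈ s then s.equivFin ⟨v, h⟩ else 0, fun v hv => by simp [hv], ?_⟩
    intro u hu v hv huv
    have hu' : u ∈ s := hu
    have hv' : v ∈ s := hv
    simpa [hu', hv', Fin.val_inj] using huv
  -- Number the elements and cut into blocks of length m; within a block the remainder mod m is
  -- injective.
  refine ⟨fun v => e v / m, fun v hv => ?_, fun j => ?_⟩
  · rw [Nat.div_lt_iff_lt_mul (by omega)]
    exact (he.1 v hv).trans_le hs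
  · refine (Finset.card_le_card_of_injOn (t := Finset.range m) (fun v => e v % m)
      (fun v _ => by simpa using Nat.mod_lt _ (by omega)) ?_).trans (by simp)
    intro u hu v hv huv
    obtain ⟨hu, hu'⟩ := Finset.mem_filter.1 hu
    obtain ⟨hv, hv'⟩ := Finset.mem_filter.1 hv
    refine he.2 hu hv ?_
    have h := huv
    dsimp only at h hu' hv'
    rw [← Nat.div_add_mod (e u) m, ← Nat.div_add_mod (e v) m, hu', hv', h]

/-! ### Degree criteria in finite graphs. -/

section Finite

variable [Fintype V] [DecidableRel G.Adj]

/-- The degrees in a bipartite graph with a krausz `(k,m)`-partition are at most `k`. -/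
theorem IsKrauszPartition.degree_le_of_bipartite (hQ : IsKrauszPartition G k m Q) {A : Set V}
    (hA : ∀ u ∈ A, ∀ v ∈ A, ¬G.Adj u v) (hB : ∀ u ∉ A, ∀ v ∉ A, ¬G.Adj u v) (v : V) :
    G.degree v ≤ k := by
  rw [← G.card_neighborFinset_eq_degree]
  refine hQ.card_indep_le (v := v) (fun u hu w hw _ huw => ?_) fun u hu => by simpa using hu
  have hu : G.Adj v u := by simpa using hu
  have hw : G.Adj v w := by simpa using hw
  by_cases hv : v ∈ A
  · exact hB u (fun h => hA v hv u h hu) w (fun h => hA v hv w h hw) huw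
  · exact hA u (by by_contra h; exact hB v hv u h hu) w (by by_contra h; exact hB v hv w h hw) huw

/-- A graph of maximum degree at most `k` has a krausz `(k,m)`-partition. -/
theorem hasKrauszPartition_of_degree_le (hm : 1 ≤ m) (hdeg : ∀ v, G.degree v ≤ k) :
    HasKrauszPartition G k m := by
  -- The clusters are the edges; two different edges share at most one vertex.
  let f : V × V → Finset V := fun e => {e.1, e.2}
  refine ⟨(Finset.univ.filter fun e : V × V => G.Adj e.1 e.2).image f, ?_, ?_, ?_, ?_⟩
  · intro C hC
    obtain ⟨⟨a, b⟩, he, rfl⟩ := Finset.mem_image.1 hC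
    have hab : G.Adj a b := by simpa using he
    simpa [f, SimpleGraph.isClique_pair] using fun _ => hab
  · intro u v huv
    exact ⟨{u, v}, Finset.mem_image.2 ⟨(u, v), by simpa using huv, rfl⟩, by simp, by simp⟩
  · intro v
    refine le_trans ?_ (hdeg v)
    rw [← G.card_neighborFinset_eq_degree]
    refine (Finset.card_le_card (t := (G.neighborFinset v).image fun u => {v, u}) ?_).trans
      Finset.card_image_le
    intro C hC
    obtain ⟨h₁, h₂⟩ := Finset.mem_filter.1 hC
    obtain ⟨⟨a, b⟩, he, rfl⟩ := Finset.mem_image.1 h₁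
    have hab : G.Adj a b := by simpa using he
    have h₂ : v = a ∨ v = b := by simpa [f] using h₂
    rcases h₂ with rfl | rfl
    · exact Finset.mem_image.2 ⟨b, by simpa using hab, rfl⟩
    · exact Finset.mem_image.2 ⟨a, by simpa using hab.symm, Finset.pair_comm _ _⟩
  · intro C hC D hD hne
    obtain ⟨⟨a, b⟩, he, rfl⟩ := Finset.mem_image.1 hC
    obtain ⟨⟨c, d⟩, he', rfl⟩ := Finset.mem_image.1 hD
    have hab : a ≠ b := G.ne_of_adj (by simpa using he)
    have hcd : c ≠ d := G.ne_of_adj (by simpa using he')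
    by_contra! hcard
    have h2 : 2 ≤ (f (a, b) ∩ f (c, d)).card := by omega
    have e₁ : f (a, b) ∩ f (c, d) = f (a, b) :=
      Finset.eq_of_subset_of_card_le Finset.inter_subset_left (by
        rwa [show (f (a, b)).card = 2 from Finset.card_pair hab])
    have e₂ : f (a, b) ∩ f (c, d) = f (c, d) :=
      Finset.eq_of_subset_of_card_le Finset.inter_subset_right (by
        rwa [show (f (c, d)).card = 2 from Finset.card_pair hcd])
    exact hne (e₁.symm.trans e₂)

/-- If the vertices of large degree form a clique, the other vertices are independent, and every
vertex of large degree has fewer than `k` neighbours of small degree, then there is a krausz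
`(k,m)`-partition. -/
theorem hasKrauszPartition_of_split (hm : 1 ≤ m)
    (hhigh : ∀ u v, k * m < G.degree u → k * m < G.degree v → u ≠ v → G.Adj u v)
    (hlow : ∀ u v, G.degree u ≤ k * m → G.degree v ≤ k * m → ¬G.Adj u v)
    (hmix : ∀ u, k * m < G.degree u →
      ((G.neighborFinset u).filter fun v => G.degree v ≤ k * m).card < k) :
    HasKrauszPartition G k m := by
  -- The clusters will be the clique of high-degree vertices and, for each low vertex b, the k sets
  -- formed by b and one part of its neighbourhood. A high vertex lies in the clique and in one
  -- cluster per low neighbour.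
  choose χ hχ hχ' using fun b : {b : V // G.degree b ≤ k * m} =>
    exists_partition_card_le hm (G.neighborFinset b) (by simpa using b.2)
  let A : Finset V := Finset.univ.filter fun v => k * m < G.degree v
  have hA : ∀ v, v ∈ A ↔ k * m < G.degree v := fun v => by simp [A]
  let N : {b : V // G.degree b ≤ k * m} → ℕ → Finset V := fun b j =>
    (G.neighborFinset b).filter fun v => χ b v = j
  have hN : ∀ b j v, v ∈ N b j ↔ G.Adj b v ∧ χ b v = j := fun b j v => by simp [N]
  have hNA : ∀ b j v, v ∈ N b j → v ∈ A := fun b j v hv => by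
    rw [hA]
    by_contra! hv'
    exact hlow b v b.2 hv' ((hN b j v).1 hv).1
  let cl : {b : V // G.degree b ≤ k * m} × ℕ → Finset V := fun p => insert p.1.1 (N p.1 p.2)
  have hcl : ∀ b j v, v ∈ cl (b, j) ↔ v = b ∨ v ∈ N b j := fun b j v => by simp [cl]
  have hbA : ∀ b : {b : V // G.degree b ≤ k * m}, b.1 ∉ A := fun b h => by
    have := (hA _).1 h
    have := b.2
    omega
  let R : Finset ({b : V // G.degree b ≤ k * m} × ℕ) := Finset.univ ×ˢ Finset.range k
  refine ⟨insert A (R.image cl), ?_, ?_, ?_, ?_⟩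
  · intro C hC
    rcases Finset.mem_insert.1 hC with rfl | hC
    · intro u hu v hv huv
      exact hhigh u v ((hA u).1 hu) ((hA v).1 hv) huv
    · obtain ⟨⟨b, j⟩, -, rfl⟩ := Finset.mem_image.1 hC
      intro u hu v hv huv
      rcases (hcl b j u).1 hu with rfl | hu <;> rcases (hcl b j v).1 hv with rfl | hv
      · exact absurd rfl huv
      · exact ((hN b j v).1 hv).1
      · exact ((hN b j u).1 hu).1.symm
      · exact hhigh u v ((hA u).1 (hNA b j u hu)) ((hA v).1 (hNA b j v hv)) huv
  · have key : ∀ u v, G.Adj u v → u ∉ A → ∃ C ∈ insert A (R.image cl), u ∈ C ∧ v ∈ C := by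
      intro u v huv hu
      let b : {b : V // G.degree b ≤ k * m} := ⟨u, by simpa [hA] using hu⟩
      refine ⟨cl (b, χ b v), Finset.mem_insert_of_mem (Finset.mem_image_of_mem _ ?_),
        (hcl _ _ _).2 (.inl rfl), (hcl _ _ _).2 (.inr ((hN _ _ _).2 ⟨huv, rfl⟩))⟩
      simpa [R] using hχ b v (by simpa using huv)
    intro u v huv
    by_cases hu : u ∈ A
    · by_cases hv : v ∈ A
      · exact ⟨A, Finset.mem_insert_self _ _, hu, hv⟩
      · obtain ⟨C, hC, h₁, h₂⟩ := key v u huv.symm hv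
        exact ⟨C, hC, h₂, h₁⟩
    · exact key u v huv hu
  · intro v
    by_cases hv : v ∈ A
    · have hv' := (hA v).1 hv
      let T : Finset {b : V // G.degree b ≤ k * m} := Finset.univ.filter fun b => G.Adj v b
      have hT : T.card < k := by
        refine lt_of_le_of_lt ?_ (hmix v hv')
        exact Finset.card_le_card_of_injOn Subtype.val
          (fun b hb => by simpa [b.2] using (Finset.mem_filter.1 hb).2)
          Subtype.val_injective.injOn
      refine (Finset.card_le_card (t := insert A (T.image fun b => cl (b, χ b v))) ?_).trans
        ((Finset.card_insert_le _ _).trans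
          (Nat.succ_le_of_lt (Finset.card_image_le.trans_lt hT)))
      intro C hC
      obtain ⟨h₁, h₂⟩ := Finset.mem_filter.1 hC
      rcases Finset.mem_insert.1 h₁ with rfl | h₁
      · exact Finset.mem_insert_self _ _
      · obtain ⟨⟨b, j⟩, -, rfl⟩ := Finset.mem_image.1 h₁
        rcases (hcl b j v).1 h₂ with rfl | h₂
        · exact absurd hv (hbA b)
        · obtain ⟨h₃, rfl⟩ := (hN b j v).1 h₂
          exact Finset.mem_insert_of_mem
            (Finset.mem_image.2 ⟨b, by simpa [T] using h₃.symm, rfl⟩)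
    · let b : {b : V // G.degree b ≤ k * m} := ⟨v, by simpa [hA] using hv⟩
      refine (Finset.card_le_card (t := (Finset.range k).image fun j => cl (b, j)) ?_).trans
        (Finset.card_image_le.trans (by simp))
      intro C hC
      obtain ⟨h₁, h₂⟩ := Finset.mem_filter.1 hC
      rcases Finset.mem_insert.1 h₁ with rfl | h₁
      · exact absurd h₂ hv
      · obtain ⟨⟨b', j⟩, hR, rfl⟩ := Finset.mem_image.1 h₁
        rcases (hcl b' j v).1 h₂ with h | h₂
        · have : b' = b := Subtype.ext h.symm
          subst this
          exact Finset.mem_image.2 ⟨j, by simpa [R] using hR, rfl⟩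
        · exact absurd (hNA b' j v h₂) hv
  · have hAcl : ∀ p, (A ∩ cl p).card ≤ m := by
      rintro ⟨b, j⟩
      refine (Finset.card_le_card (t := N b j) fun v hv => ?_).trans (hχ' b j)
      obtain ⟨h₁, h₂⟩ := Finset.mem_inter.1 hv
      rcases (hcl b j v).1 h₂ with rfl | h₂
      · exact absurd h₁ (hbA b)
      · exact h₂
    intro C hC D hD hne
    rcases Finset.mem_insert.1 hC with rfl | hC <;> rcases Finset.mem_insert.1 hD with rfl | hD
    · exact absurd rfl hne
    · obtain ⟨p, -, rfl⟩ := Finset.mem_image.1 hD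
      exact hAcl p
    · obtain ⟨p, -, rfl⟩ := Finset.mem_image.1 hC
      rw [Finset.inter_comm]
      exact hAcl p
    · obtain ⟨⟨b, j⟩, -, rfl⟩ := Finset.mem_image.1 hC
      obtain ⟨⟨b', j'⟩, -, rfl⟩ := Finset.mem_image.1 hD
      by_cases hb : b = b'
      · subst hb
        have hj : j ≠ j' := fun h => hne (h ▸ rfl)
        refine (Finset.card_le_card (t := {b.1}) fun v hv => ?_).trans (by simpa using hm)
        obtain ⟨h₁, h₂⟩ := Finset.mem_inter.1 hv
        rcases (hcl b j v).1 h₁ with h | h₁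
        · simpa using h
        · rcases (hcl b j' v).1 h₂ with h | h₂
          · simpa using h
          · exact absurd (((hN b j v).1 h₁).2.symm.trans ((hN b j' v).1 h₂).2) hj
      · refine (Finset.card_le_card (t := A ∩ cl (b, j)) fun v hv => ?_).trans (hAcl _)
        obtain ⟨h₁, h₂⟩ := Finset.mem_inter.1 hv
        refine Finset.mem_inter.2 ⟨?_, h₁⟩
        rcases (hcl b j v).1 h₁ with h | h₁
        · rcases (hcl b' j' v).1 h₂ with h' | h₂
          · exact absurd (Subtype.ext (h.symm.trans h')) hb
          · exact hNA _ _ _ h₂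
        · exact hNA _ _ _ h₁

/-- If a polar graph with a krausz `(k,m)`-partition has a vertex of very large degree, then its
vertices of degree more than `k * m` form a clique, its other vertices are independent, and every
vertex of degree more than `k * m` has fewer than `k` neighbours of smaller degree. -/
theorem IsKrauszPartition.split_of_large_degree (hQ : IsKrauszPartition G k m Q) {A : Set V}
    (hA : ∀ u ∈ A, ∀ v ∈ A, ∀ w ∈ A, ¬G.Adj u v → ¬G.Adj v w → ¬G.Adj u w)
    (hB : ∀ u ∉ A, ∀ v ∉ A, ¬G.Adj u v) {v₀ : V}
    (hv₀ : k * (k * (k * m) + k * m + m + 1) + k < G.degree v₀) :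
    (∀ u v, k * m < G.degree u → k * m < G.degree v → u ≠ v → G.Adj u v) ∧
    (∀ u v, G.degree u ≤ k * m → G.degree v ≤ k * m → ¬G.Adj u v) ∧
    ∀ u, k * m < G.degree u →
      ((G.neighborFinset u).filter fun v => G.degree v ≤ k * m).card < k := by
  classical
  obtain ⟨a, ha, a', ha', haa'⟩ : ∃ a ∈ A, ∃ a' ∈ A, G.Adj a a' := by
    by_contra! h
    have := hQ.degree_le_of_bipartite h hB v₀
    omega
  let F : Finset V := Finset.univ.filter fun v => v ∈ A
  have hF : ∀ v, v ∈ F ↔ v ∈ A := fun v => by simp [F]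
  obtain ⟨T, hT, hTmax⟩ := Finset.exists_max_image
    (F.powerset.filter fun T : Finset V => G.IsClique (T : Set V)) Finset.card ⟨∅, by simp⟩
  simp only [Finset.mem_filter, Finset.mem_powerset] at hT hTmax
  obtain ⟨hTF, hT⟩ := hT
  have hT2 : 2 ≤ T.card := by
    rw [← Finset.card_pair haa'.ne]
    refine hTmax _ ⟨?_, by simpa [SimpleGraph.isClique_pair] using fun _ => haa'⟩
    intro x hx
    rcases Finset.mem_insert.1 hx with rfl | hx
    · exact (hF _).2 ha
    · rw [Finset.mem_singleton.1 hx]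
      exact (hF _).2 ha'
  have hTA : ∀ t ∈ T, t ∈ A := fun t ht => (hF t).1 (hTF ht)
  have hcov : ∀ x ∈ A, ∃ t ∈ T, ¬G.Adj t x := by
    intro x hx
    by_contra! h
    have hxT : x ∉ T := fun hxT => (h x hxT).ne rfl
    have := hTmax (insert x T) ⟨Finset.insert_subset ((hF x).2 hx) hTF, by
      rw [Finset.coe_insert, SimpleGraph.isClique_insert_of_notMem (by simpa using hxT)]
      exact ⟨hT, fun t ht => (h t ht).symm⟩⟩
    rw [Finset.card_insert_of_notMem hxT] at this
    omega
  -- A nonadjacency class of `A` consists of neighbours of any vertex of `T` from another class, so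
  -- it has at most k elements.
  have hFcard : F.card ≤ T.card * k := by
    refine (Finset.card_le_card (t := T.biUnion fun t => F.filter fun x => ¬G.Adj t x) ?_).trans
      (Finset.card_biUnion_le_card_mul _ _ k ?_)
    · intro x hx
      obtain ⟨t, ht, htx⟩ := hcov x ((hF x).1 hx)
      exact Finset.mem_biUnion.2 ⟨t, ht, Finset.mem_filter.2 ⟨hx, htx⟩⟩
    · intro t ht
      obtain ⟨t', ht', hne⟩ := Finset.exists_mem_ne (by omega : 1 < T.card) t
      refine hQ.card_indep_le (v := t') (fun x hx y hy _ => ?_) fun x hx => ?_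
      · obtain ⟨hxF, hx⟩ := Finset.mem_filter.1 hx
        obtain ⟨hyF, hy⟩ := Finset.mem_filter.1 hy
        exact hA x ((hF x).1 hxF) t (hTA t ht) y ((hF y).1 hyF) (fun h => hx h.symm) hy
      · obtain ⟨hxF, hx⟩ := Finset.mem_filter.1 hx
        by_contra h
        exact hA t' (hTA t' ht') x ((hF x).1 hxF) t (hTA t ht) h (fun h => hx h.symm)
          (hT ht' ht hne)
  have hdeg : G.degree v₀ ≤ F.card + k := by
    have hI : (G.neighborFinset v₀ \ F).card ≤ k := by
      refine hQ.card_indep_le (v := v₀) (fun x hx y hy _ => ?_) fun x hx => ?_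
      · exact hB x (fun h => (Finset.mem_sdiff.1 hx).2 ((hF x).2 h)) y
          fun h => (Finset.mem_sdiff.1 hy).2 ((hF y).2 h)
      · simpa using (Finset.mem_sdiff.1 hx).1
    have h := Finset.card_le_card_sdiff_add_card (s := G.neighborFinset v₀) (t := F)
    rw [G.card_neighborFinset_eq_degree] at h
    omega
  -- The summands provide for three uses: k·km + 1 puts `T` into a cluster, m + 1 contradicts the
  -- intersection bound, and km + 1 gives the members of the cluster degree more than km.
  have hTcard : k * (k * m) + k * m + m + 1 < T.card := by
    have : k * (k * (k * m) + k * m + m + 1) < k * T.card := by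
      rw [mul_comm k T.card]
      omega
    exact Nat.lt_of_mul_lt_mul_left this
  obtain ⟨C, hC, hTC⟩ := hQ.exists_cluster_of_large hT (by omega)
  have hAC : ∀ x ∈ A, x ∈ C := by
    intro x hx
    by_cases hxT : x ∈ T
    · exact hTC hxT
    exfalso
    obtain ⟨t, ht, htx⟩ := hcov x hx
    have hxe : x ∉ T.erase t := fun h => hxT (Finset.mem_of_mem_erase h)
    have hcl : G.IsClique ((insert x (T.erase t) : Finset V) : Set V) := by
      rw [Finset.coe_insert, SimpleGraph.isClique_insert_of_notMem (by exact_mod_cast hxe)]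
      refine ⟨hT.subset (by simp), fun u hu => ?_⟩
      obtain ⟨hut, hu⟩ := Finset.mem_erase.1 hu
      by_contra h
      exact hA u (hTA u hu) x hx t (hTA t ht) (fun h' => h h'.symm) (fun h' => htx h'.symm)
        (hT hu ht hut)
    have hcard : (insert x (T.erase t)).card = T.card := by
      rw [Finset.card_insert_of_notMem hxe, Finset.card_erase_add_one ht]
    -- `x` and `t` are nonadjacent, so the exchanged clique lies in a different cluster, yet the two
    -- clusters share `T.erase t`.
    obtain ⟨C', hC', hTC'⟩ := hQ.exists_cluster_of_large hcl (by omega)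
    have hne : C ≠ C' := by
      rintro rfl
      exact htx (hQ.isClique C hC (hTC ht) (hTC' (Finset.mem_insert_self _ _))
        fun h => hxT (h ▸ ht))
    have h₁ := hQ.card_inter_le C hC C' hC' hne
    have h₂ : (T.erase t).card ≤ (C ∩ C').card := Finset.card_le_card fun u hu =>
      Finset.mem_inter.2 ⟨hTC (Finset.mem_of_mem_erase hu), hTC' (Finset.mem_insert_of_mem hu)⟩
    rw [Finset.card_erase_of_mem ht] at h₂
    omega
  have hCdeg : ∀ u, u ∈ C ↔ k * m < G.degree u := by
    intro u
    constructor
    · intro hu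
      have h₁ : (C.erase u).card ≤ G.degree u := by
        rw [← G.card_neighborFinset_eq_degree]
        refine Finset.card_le_card fun w hw => ?_
        obtain ⟨hne, hw⟩ := Finset.mem_erase.1 hw
        simpa using hQ.isClique C hC hu hw hne.symm
      rw [Finset.card_erase_of_mem hu] at h₁
      have := Finset.card_le_card hTC
      omega
    · intro hu
      by_contra huC
      refine hu.not_ge ?_
      rw [← G.card_neighborFinset_eq_degree]
      refine hQ.card_inter_cluster_le hC huC (fun w hw => hAC w ?_) fun w hw => by simpa using hw
      by_contra hw'
      exact hB u (fun h => huC (hAC u h)) w hw' (by simpa using hw)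
  refine ⟨fun u v hu hv huv => hQ.isClique C hC ((hCdeg u).2 hu) ((hCdeg v).2 hv) huv,
    fun u v hu hv => hB u (fun h => ?_) v fun h => ?_, fun u hu => ?_⟩
  · exact hu.not_gt ((hCdeg u).1 (hAC u h))
  · exact hv.not_gt ((hCdeg v).1 (hAC v h))
  · have huC := (hCdeg u).2 hu
    -- The low neighbours of `u` lie outside `C`, so only the at most k - 1 other clusters through
    -- `u` can cover the edges to them.
    have hlt : ((Q.filter fun D => u ∈ D).erase C).card < (Q.filter fun D => u ∈ D).card :=
      Finset.card_erase_lt_of_mem (Finset.mem_filter.2 ⟨hC, huC⟩)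
    refine lt_of_le_of_lt ?_ (hlt.trans_le (hQ.card_clusters_le u))
    have hI : ∀ x ∈ (G.neighborFinset u).filter fun v => G.degree v ≤ k * m,
        G.Adj u x ∧ x ∉ C := fun x hx => by
      obtain ⟨h₁, h₂⟩ := Finset.mem_filter.1 hx
      exact ⟨by simpa using h₁, fun h => h₂.not_gt ((hCdeg x).1 h)⟩
    refine hQ.card_le_of_cover ((Finset.erase_subset _ _).trans (Finset.filter_subset _ _))
      (fun x hx y hy _ => ?_) fun x hx => ?_
    · exact hB x (fun h => (hI x hx).2 (hAC x h)) y fun h => (hI y hy).2 (hAC y h)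
    · obtain ⟨hux, hxC⟩ := hI x hx
      obtain ⟨D, hD, h₁, h₂⟩ := hQ.covers _ _ hux
      exact ⟨D, Finset.mem_erase.2 ⟨fun h => hxC (h ▸ h₂), Finset.mem_filter.2 ⟨hD, h₁⟩⟩, h₂⟩

/-- A polar graph of bounded degree that is not bipartite has few vertices of positive degree. -/
theorem card_pos_degree_le {D : ℕ} {A : Set V}
    (hA : ∀ u ∈ A, ∀ v ∈ A, ∀ w ∈ A, ¬G.Adj u v → ¬G.Adj v w → ¬G.Adj u w)
    (hB : ∀ u ∉ A, ∀ v ∉ A, ¬G.Adj u v) (hD : ∀ v, G.degree v ≤ D) {a a' : V} (ha : a ∈ A)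
    (ha' : a' ∈ A) (haa' : G.Adj a a') :
    (Finset.univ.filter fun v => 0 < G.degree v).card ≤ 2 * D + 2 * D * D := by
  -- A vertex of `A` adjacent to neither end of the edge would make the ends nonadjacent; so `N`
  -- contains `A`, and every other vertex of positive degree has a neighbour in `N`.
  let N := G.neighborFinset a ∪ G.neighborFinset a'
  have hN : N.card ≤ 2 * D := by
    refine (Finset.card_union_le _ _).trans ?_
    have h₁ := hD a
    have h₂ := hD a'
    simp only [G.card_neighborFinset_eq_degree]
    omega
  have hAN : ∀ u ∈ A, u ∈ N := by
    intro u hu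
    by_contra h
    simp only [N, Finset.mem_union, SimpleGraph.mem_neighborFinset, not_or] at h
    exact hA a ha u hu a' ha' h.1 (fun h' => h.2 h'.symm) haa'
  refine (Finset.card_le_card (t := N ∪ N.biUnion fun w => G.neighborFinset w) ?_).trans
    ((Finset.card_union_le _ _).trans (add_le_add hN
      ((Finset.card_biUnion_le_card_mul _ _ D fun w _ => ?_).trans (Nat.mul_le_mul_right D hN))))
  · intro u hu
    by_cases huA : u ∈ A
    · exact Finset.mem_union_left _ (hAN u huA)
    · obtain ⟨w, hw⟩ := (G.degree_pos_iff_exists_adj u).1 (by simpa using hu)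
      refine Finset.mem_union_right _ (Finset.mem_biUnion.2 ⟨w, hAN w ?_, by simpa using hw.symm⟩)
      by_contra hwA
      exact hB u huA w hwA hw
  · rw [G.card_neighborFinset_eq_degree]
    exact hD w

end Finite

end Krausz

/-! ### Truncated degrees and the core matrix. -/

namespace Krausz

/-- The automaton that counts the entries `true` of a row, up to `D + 1`. -/
def degreeDFA (D : ℕ) : DFA Bool (Fin (D + 2)) where
  step s b := if b then ⟨min (s + 1) (D + 1), by omega⟩ else s
  start := 0
  accept := ∅

theorem degreeDFA_evalFrom (D : ℕ) (r : List Bool) : ∀ s : Fin (D + 2),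
    ((degreeDFA D).evalFrom s r : ℕ) = min (s + r.countP id) (D + 1) := by
  induction r with
  | nil =>
    intro s
    have := s.2
    simp
    omega
  | cons b r ih =>
    intro s
    rw [DFA.evalFrom_cons, ih]
    cases b
    · simp [degreeDFA]
    · simp [degreeDFA]
      omega

theorem countP_finRange {n : ℕ} (p : Fin n → Prop) [DecidablePred p] :
    (List.finRange n).countP (fun i => decide (p i)) = (Finset.univ.filter p).card := by
  simp [List.countP_eq_length_filter, Finset.card, Finset.filter, Fin.univ_def]

section

open Classical

theorem degreeDFA_eval (D : ℕ) {n : ℕ} (G : SimpleGraph (Fin n)) (i : Fin n) :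
    ((degreeDFA D).eval ((List.finRange n).map fun j => decide (G.Adj i j)) : ℕ) =
      min (G.degree i) (D + 1) := by
  have h : ((List.finRange n).map fun j => decide (G.Adj i j)).countP id = G.degree i := by
    rw [List.countP_map, ← G.card_neighborFinset_eq_degree, SimpleGraph.neighborFinset_eq_filter,
      ← countP_finRange]
    rfl
  rw [DFA.eval, degreeDFA_evalFrom, h]
  simp [degreeDFA]

/-- The vertices of positive degree. -/
noncomputable def core {n : ℕ} (G : SimpleGraph (Fin n)) : List (Fin n) :=
  (List.finRange n).filter fun i => 0 < G.degree i

/-- The adjacency matrix of the subgraph induced by the vertices of positive degree. -/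
noncomputable def coreBits {n : ℕ} (G : SimpleGraph (Fin n)) : List Bool :=
  (core G).flatMap fun i => (core G).map fun j => decide (G.Adj i j)

theorem length_coreBits {n : ℕ} (G : SimpleGraph (Fin n)) :
    (coreBits G).length = (core G).length * (core G).length := by
  simp [coreBits]

theorem length_core {n : ℕ} (G : SimpleGraph (Fin n)) :
    (core G).length = (Finset.univ.filter fun v => 0 < G.degree v).card := by
  rw [← countP_finRange, core, List.countP_eq_length_filter]

/-- The existence of a krausz partition depends only on the subgraph induced by the vertices of
positive degree. -/
theorem hasKrauszPartition_of_coreBits_eq {k m n n' : ℕ} {G : SimpleGraph (Fin n)}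
    {G' : SimpleGraph (Fin n')} (h : coreBits G = coreBits G') (hG' : HasKrauszPartition G' k m) :
    HasKrauszPartition G k m := by
  -- The bit strings have square length, which determines the order of the core and hence the
  -- division into rows.
  have hlen : (core G).length = (core G').length := by
    have := congrArg List.length h
    rw [length_coreBits, length_coreBits] at this
    exact Nat.mul_self_inj.1 this
  have hrows : ((core G).map fun i => (core G).map fun j => decide (G.Adj i j)) =
      (core G').map fun i => (core G').map fun j => decide (G'.Adj i j) := by
    rw [List.eq_iff_flatten_eq]
    refine ⟨by simpa only [coreBits, List.flatMap_def] using h, ?_⟩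
    simp [Function.comp_def, hlen]
  have nd : ∀ {n : ℕ} (G : SimpleGraph (Fin n)), (core G).Nodup := fun G =>
    (List.nodup_finRange _).filter _
  let φ : Fin (core G).length ↪ Fin n :=
    ⟨fun p => (core G)[p], fun p q hpq => Fin.ext ((nd G).getElem_inj_iff.1 hpq)⟩
  let φ' : Fin (core G).length ↪ Fin n' :=
    ⟨fun p => (core G')[p.1]'(hlen ▸ p.2), fun p q hpq => Fin.ext ((nd G').getElem_inj_iff.1 hpq)⟩
  have hadj : ∀ p q, (G.comap φ).Adj p q ↔ G'.Adj (φ' p) (φ' q) := by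
    intro p q
    have hp' : p.1 < (core G').length := hlen ▸ p.2
    have hq' : q.1 < (core G').length := hlen ▸ q.2
    have h₁ := congrArg (fun L => (L[p.1]?.getD [])[q.1]?) hrows
    simp only [List.getElem?_map, List.getElem?_eq_getElem, p.2, q.2, hp', hq', Option.map_some,
      Option.getD_some, Option.some.injEq, decide_eq_decide] at h₁
    exact h₁
  obtain ⟨Q', hQ'⟩ := hG'
  obtain ⟨Q, hQ⟩ := hQ'.comap φ' hadj
  refine hQ.map φ (fun _ _ => Iff.rfl) fun u v huv => ?_
  have hu : u ∈ core G := by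
    simpa [core] using (G.degree_pos_iff_exists_adj u).2 ⟨v, huv⟩
  obtain ⟨p, hp, rfl⟩ := List.getElem_of_mem hu
  exact ⟨⟨p, hp⟩, rfl⟩

/-- The letter that the degree automaton attaches to a pair of vertices. -/
noncomputable def letter (D : ℕ) {n : ℕ} (G : SimpleGraph (Fin n)) (i j : Fin n) :
    Fin (D + 2) × Fin (D + 2) × Bool :=
  (⟨min (G.degree i) (D + 1), by omega⟩, ⟨min (G.degree j) (D + 1), by omega⟩,
    decide (G.Adj i j))

theorem annotatedMatrix_degreeDFA (D : ℕ) (G : FinGraph) :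
    annotatedMatrix (degreeDFA D) G =
      (List.finRange G.1).flatMap fun i =>
        (List.finRange G.1).map (fun j => some (letter D G.2 i j)) ++ [none] := by
  unfold annotatedMatrix
  congr 1
  funext i
  congr 1
  refine List.map_congr_left fun j _ => ?_
  simp only [letter, Option.some.injEq, Prod.mk.injEq, Fin.ext_iff, degreeDFA_eval, and_self]

theorem annotatedMatrix_mem_rowBounded (D : ℕ) (G : FinGraph)
    (p : Fin (D + 2) × Fin (D + 2) × Bool → Prop) (t : ℕ) :
    annotatedMatrix (degreeDFA D) G ∈ rowBounded p t ↔
      ∀ i, (Finset.univ.filter fun j => p (letter D G.2 i j)).card ≤ t := by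
  have h := flatMap_mem_rowBounded p t
    ((List.finRange G.1).map fun i => (List.finRange G.1).map (letter D G.2 i))
  simp only [List.flatMap_map, List.map_map, Function.comp_def] at h
  rw [annotatedMatrix_degreeDFA, h]
  simp [List.countP_map, Function.comp_def, ← countP_finRange]

/-- The entries of the annotated matrix that belong to two vertices of positive degree. -/
def coreEntry (D : ℕ) : Option (Fin (D + 2) × Fin (D + 2) × Bool) → Option Bool
  | none => none
  | some (a, b, x) => if 0 < a.1 ∧ 0 < b.1 then some x else none

/-- Whether both ends have positive degree is visible in each letter, so a letterwise filter
extracts the core; this makes the table lookup regular. -/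
theorem filterMap_annotatedMatrix (D : ℕ) (G : FinGraph) :
    (annotatedMatrix (degreeDFA D) G).filterMap (coreEntry D) = coreBits G.2 := by
  have aux : ∀ (q : Fin G.1 → Prop) [DecidablePred q] (f : Fin G.1 → List Bool) (l : List (Fin G.1)),
      l.flatMap (fun i => if q i then f i else []) =
        (l.filter fun i => decide (q i)).flatMap f := by
    intro q _ f l
    induction l with
    | nil => rfl
    | cons a l ih => by_cases h : q a <;> simp [h, ih]
  have aux' : ∀ (q : Fin G.1 → Prop) [DecidablePred q] (f : Fin G.1 → Bool) (l : List (Fin G.1)),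
      l.filterMap (fun i => if q i then some (f i) else none) =
        (l.filter fun i => decide (q i)).map f := by
    intro q _ f l
    induction l with
    | nil => rfl
    | cons a l ih => by_cases h : q a <;> simp [h, ih]
  rw [annotatedMatrix_degreeDFA, List.filterMap_flatMap, coreBits, core, ← aux]
  congr 1
  funext i
  rw [List.filterMap_append, List.filterMap_map, ← aux']
  by_cases hi : 0 < G.2.degree i <;> simp [hi, Function.comp_def, coreEntry, letter]

end

/-! ### The language of the decision procedure. -/

open Classical in
/-- The words accepted by the decision procedure. -/
noncomputable def krauszLanguage (k m D M : ℕ) :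
    Language (Option (Fin (D + 2) × Fin (D + 2) × Bool)) :=
  (rowBounded (fun a => k * m < a.1.1 ∧ k * m < a.2.1.1 ∧ a.2.2 = false) 1 ⊓
    (rowBounded (fun a => a.1.1 ≤ k * m ∧ a.2.1.1 ≤ k * m ∧ a.2.2 = true) 0 ⊓
    rowBounded (fun a => k * m < a.1.1 ∧ a.2.1.1 ≤ k * m ∧ a.2.2 = true) (k - 1))) +
  rowBounded (fun a => D < a.1.1) 0 ⊓
    ((filterLanguage (coreEntry D) {l | l.length ≤ M})ᶜ ⊓
      rowBounded (fun a => k < a.1.1) 0 +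
    filterLanguage (coreEntry D) {l | l.length ≤ M ∧
      ∃ G : FinGraph, coreBits G.2 = l ∧ HasKrauszPartition G.2 k m})

theorem isRegular_krauszLanguage (k m D M : ℕ) : (krauszLanguage k m D M).IsRegular :=
  ((isRegular_rowBounded _ _).inf
    ((isRegular_rowBounded _ _).inf (isRegular_rowBounded _ _))).add
  ((isRegular_rowBounded _ _).inf
    ((((isRegular_filterLanguage _ _ M fun _ h => h).compl).inf (isRegular_rowBounded _ _)).add
      (isRegular_filterLanguage _ _ M fun _ h => h.1)))

-- Addition of languages is union. The counter saturates at `D + 1`, so comparisons of degrees with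
-- `k * m`, `k` and `D` are faithful because these thresholds are at most `D`.
open Classical in
theorem mem_krauszLanguage {k m D M : ℕ} (hk : 1 ≤ k) (hkD : k ≤ D) (hD : k * m ≤ D)
    (G : FinGraph) :
    annotatedMatrix (degreeDFA D) G ∈ krauszLanguage k m D M ↔
      ((∀ u v, k * m < G.2.degree u → k * m < G.2.degree v → u ≠ v → G.2.Adj u v) ∧
        (∀ u v, G.2.degree u ≤ k * m → G.2.degree v ≤ k * m → ¬G.2.Adj u v) ∧
        ∀ u, k * m < G.2.degree u →
          ((G.2.neighborFinset u).filter fun v => G.2.degree v ≤ k * m).card < k) ∨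
      (∀ v, G.2.degree v ≤ D) ∧ ((M < (coreBits G.2).length ∧ ∀ v, G.2.degree v ≤ k) ∨
        ((coreBits G.2).length ≤ M ∧ HasKrauszPartition G.2 k m)) := by
  have hlt : ∀ (c : ℕ) (v : Fin G.1), c ≤ D → (c < min (G.2.degree v) (D + 1) ↔
      c < G.2.degree v) := fun c v h => by omega
  have hle : ∀ (c : ℕ) (v : Fin G.1), c ≤ D → (min (G.2.degree v) (D + 1) ≤ c ↔
      G.2.degree v ≤ c) := fun c v h => by omega
  -- The bound is 1 because the diagonal entry of a high row is always false.
  have h₁ : annotatedMatrix (degreeDFA D) G ∈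
      rowBounded (fun a => k * m < a.1.1 ∧ k * m < a.2.1.1 ∧ a.2.2 = false) 1 ↔
      ∀ u v, k * m < G.2.degree u → k * m < G.2.degree v → u ≠ v → G.2.Adj u v := by
    rw [annotatedMatrix_mem_rowBounded]
    simp only [letter, hlt _ _ hD, decide_eq_false_iff_not, Finset.card_le_one,
      Finset.mem_filter, Finset.mem_univ, true_and]
    constructor
    · intro h u v hu hv huv
      by_contra hadj
      exact huv (h u u ⟨hu, hu, G.2.irrefl⟩ v ⟨hu, hv, hadj⟩)
    · rintro h i a ⟨hi, ha, hia⟩ b ⟨-, hb, hib⟩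
      have e₁ : i = a := by
        by_contra hne
        exact hia (h i a hi ha hne)
      have e₂ : i = b := by
        by_contra hne
        exact hib (h i b hi hb hne)
      exact e₁.symm.trans e₂
  have h₂ : annotatedMatrix (degreeDFA D) G ∈
      rowBounded (fun a => a.1.1 ≤ k * m ∧ a.2.1.1 ≤ k * m ∧ a.2.2 = true) 0 ↔
      ∀ u v, G.2.degree u ≤ k * m → G.2.degree v ≤ k * m → ¬G.2.Adj u v := by
    rw [annotatedMatrix_mem_rowBounded]
    simp only [letter, hle _ _ hD, decide_eq_true_eq, Nat.le_zero, Finset.card_eq_zero,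
      Finset.filter_eq_empty_iff, Finset.mem_univ, true_implies, not_and]
  have h₃ : annotatedMatrix (degreeDFA D) G ∈
      rowBounded (fun a => k * m < a.1.1 ∧ a.2.1.1 ≤ k * m ∧ a.2.2 = true) (k - 1) ↔
      ∀ u, k * m < G.2.degree u →
        ((G.2.neighborFinset u).filter fun v => G.2.degree v ≤ k * m).card < k := by
    rw [annotatedMatrix_mem_rowBounded]
    refine forall_congr' fun u => ?_
    simp only [letter, hlt _ _ hD, hle _ _ hD, decide_eq_true_eq]
    by_cases hu : k * m < G.2.degree u
    · simp only [hu, true_and, true_implies]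
      rw [SimpleGraph.neighborFinset_eq_filter, Finset.filter_filter]
      simp only [and_comm]
      omega
    · simp [hu]
  have h₄ : ∀ c ≤ D, (annotatedMatrix (degreeDFA D) G ∈
      rowBounded (fun a => c < a.1.1) 0 ↔ ∀ v, G.2.degree v ≤ c) := by
    intro c hc
    rw [annotatedMatrix_mem_rowBounded]
    simp only [letter, hlt _ _ hc, Nat.le_zero, Finset.card_eq_zero,
      Finset.filter_eq_empty_iff, Finset.mem_univ, true_implies, not_lt]
    exact ⟨fun h v => h v (x := v), fun h v _ => h v⟩
  have h₅ : annotatedMatrix (degreeDFA D) G ∈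
      ((filterLanguage (coreEntry D) {l | l.length ≤ M})ᶜ) ↔
      M < (coreBits G.2).length := by
    change ¬((annotatedMatrix (degreeDFA D) G).filterMap (coreEntry D)).length ≤ M ↔ _
    rw [filterMap_annotatedMatrix, not_le]
  -- The table may be filled using any graph with the given core, as the answer depends on the core
  -- alone.
  have h₆ : annotatedMatrix (degreeDFA D) G ∈
      filterLanguage (coreEntry D) {l | l.length ≤ M ∧
        ∃ G : FinGraph, coreBits G.2 = l ∧ HasKrauszPartition G.2 k m} ↔
      (coreBits G.2).length ≤ M ∧ HasKrauszPartition G.2 k m := by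
    change (annotatedMatrix (degreeDFA D) G).filterMap (coreEntry D) ∈ {l : List Bool | _} ↔ _
    rw [filterMap_annotatedMatrix]
    exact and_congr_right fun _ =>
      ⟨fun ⟨G', h, hG'⟩ => hasKrauszPartition_of_coreBits_eq h.symm hG', fun h => ⟨G, rfl, h⟩⟩
  rw [← h₁, ← h₂, ← h₃, ← h₄ D le_rfl, ← h₄ k hkD, ← h₅, ← h₆]
  rfl

end Krausz

theorem mainTheorem7 (k m : ℕ) (hk : 1 ≤ k) (hm : 1 ≤ m) :
    Krausz.PolySolvableOn (fun G => Krausz.IsPolar ⊤ 1 G.2)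
      (fun G => Krausz.kdim m G.2 ≤ (k : ℕ∞)) := by
  classical
  -- `D` is the threshold of `split_of_large_degree`, and `N` the bound of `card_pos_degree_le` for
  -- it.
  obtain ⟨D, hD⟩ : ∃ D, D = k * (k * (k * m) + k * m + m + 1) + k := ⟨_, rfl⟩
  obtain ⟨N, hN⟩ : ∃ N, N = 2 * D + 2 * D * D := ⟨_, rfl⟩
  have hkmD : k * m ≤ D := by
    rw [hD]
    exact (Nat.mul_le_mul_left k (by omega)).trans (Nat.le_add_right _ _)
  refine ⟨fun G => decide (Krausz.annotatedMatrix (Krausz.degreeDFA D) G ∈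
    Krausz.krauszLanguage k m D (N * N)), Krausz.isPolyTime_of_isRegular (Krausz.degreeDFA D)
      (Krausz.isRegular_krauszLanguage k m D (N * N)) _ (by simp), fun G hG => ?_⟩
  rw [decide_eq_true_iff, Krausz.mem_krauszLanguage hk (by omega) hkmD]
  refine Iff.trans ?_ Krausz.kdim_le_iff.symm
  constructor
  -- Soundness holds for every graph; polarity enters only in the converse.
  · rintro (⟨h₁, h₂, h₃⟩ | ⟨-, ⟨-, h⟩ | ⟨-, h⟩⟩)
    · exact Krausz.hasKrauszPartition_of_split hm h₁ h₂ h₃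
    · exact Krausz.hasKrauszPartition_of_degree_le hm h
    · exact h
  · rintro ⟨Q, hQ⟩
    obtain ⟨A, hA, hB⟩ := Krausz.IsPolar.exists_set hG
    by_cases hdeg : ∀ v, G.2.degree v ≤ D
    · refine .inr ⟨hdeg, ?_⟩
      rcases lt_or_ge (N * N) (Krausz.coreBits G.2).length with hlen | hlen
      -- More than `N * N` core bits mean more than `N` vertices of positive degree, so `A` spans no
      -- edge.
      · refine .inl ⟨hlen, hQ.degree_le_of_bipartite (A := A) (fun a ha a' ha' haa' => ?_) hB⟩
        rw [Krausz.length_coreBits, Krausz.length_core] at hlen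
        have := Krausz.card_pos_degree_le hA hB hdeg ha ha' haa'
        rw [← hN] at this
        exact hlen.not_ge (Nat.mul_le_mul this this)
      · exact .inr ⟨hlen, Q, hQ⟩
    · push Not at hdeg
      obtain ⟨v, hv⟩ := hdeg
      exact .inl (hQ.split_of_large_degree hA hB (hD ▸ hv))
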